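/- Let $p\ge 2$, $\mathcal S_p=\{(i,j):1\le i<j\le p\}$ and $\mathcal M=\{0,1\}^{\mathcal S_p}\cong\{0,1\}^{p(p-1)/2}$. A sparsity pattern $m\in\mathcal M$ is identified with the undirected graph on $\{1,\dots,p\}$ whose edge set is $E_m=\{\{i,j\}: i<j,\ m_{(i,j)}=1\}$, and $|m|_1$ is its number of edges. Let two (realized) samples $x_1,\dots,x_{n_1}\in\mathbb R^p$ and $x'_1,\dots,x'_{n_2}\in\mathbb R^p$ be given. Put $\widehat\Sigma^{(1)}=\frac1{n_1}\sum_{i=1}^{n_1} x_ix_i^T$, and let $\widehat S^{(2)}\in\mathbb R^{p\times p}$ be any estimator of the covariance matrix, i.e. any matrix-valued function of the second sample. For $m\in\mathcal M$ let $$\mathcal C_m=\{\Theta\succ0:\ \theta_{ij}=0 \text{ for all } i\ne j \text{ with } \{i,j\}\notin E_m\},$$ and assume that for each $m\in\mathcal M$ the constrained maximum likelihood estimator $$\widehat\Theta_m=\operatorname*{argmax}_{\Theta\in\mathcal C_m}\{\log\det\Theta-\operatorname{tr}(\widehat\Sigma^{(1)}\Theta)\}$$ exists and is unique. Let $(\pi_m)_{m\in\mathcal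 M}$ be one of the following three prior distributions on $\mathcal M$: $\pi_m=\frac1H\Big(\frac{|m|_1}{e\,p(p-1)}\Big)^{|m|_1}$, with $0^0=1$ and $H$ the normalizing constant; or $\pi_m=\Big[\big(\tfrac{p(p-1)}2+1\big)\binom{p(p-1)/2}{|m|_1}\Big]^{-1}$; or the uniform distribution on $\mathcal M$. Define the weights $$v_m=\frac{\exp\{\frac{n_2}2(\log\det\widehat\Theta_m-\operatorname{tr}(\widehat\Theta_m\widehat S^{(2)}))\}\,\pi_m}{\sum_{m'\in\mathcal M}\exp\{\frac{n_2}2(\log\det\widehat\Theta_{m'}-\operatorname{tr}(\widehat\Theta_{m'}\widehat S^{(2)}))\}\,\pi_{m'}}$$ and the graphical Exponential Screening (gES) estimator $\widehat\Theta_{\mathrm{gES}}=\sum_{m\in\mathcal M}v_m\widehat\Theta_m$. Let $(m_t)_{t\ge0}$ be generated by the following Metropolis–Hastings algorithm on the hypercube $\mathcal M$. Start at $m_0=(0,\dots,0)$. At each time $t\ge0$, given $m_0,\dots,m_t$, draw $m'_t$ uniformly from the neighbours of $m_t$, i.e. from the patterns at Manhattan distance one from $m_t$. Draw $r_t$ uniformly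 from $[0,1]$, independently of $(m_0,\dots,m_t,m'_t)$. Put $m_{t+1}=m'_t$ if $r_t<\min\{1,v_{m'_t}/v_{m_t}\}$, and $m_{t+1}=m_t$ otherwise. Then for every integer $T_0\ge0$, almost surely, $$\lim_{T\to\infty}\frac1T\sum_{t=T_0+1}^{T_0+T}\widehat\Theta_{m_t}=\sum_{m\in\mathcal M}v_m\widehat\Theta_m=\widehat\Theta_{\mathrm{gES}} .$$ -/

import Mathlib

open MeasureTheory ProbabilityTheory Filter Topology

noncomputable section

namespace GES

/-- The index set of the possible edges, `{(i, j) : i < j}`; it has `p (p - 1) / 2` elements. -/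
abbrev EdgeIdx (p : ℕ) : Type := {e : Fin p × Fin p // e.1 < e.2}

/-- A sparsity pattern: a point of the hypercube `{0, 1}^{p (p - 1) / 2}`. -/
abbrev Pattern (p : ℕ) : Type := EdgeIdx p → Fin 2

/-- The `ℓ₁` norm of a sparsity pattern, that is, its number of edges. -/
def patternNorm {p : ℕ} (m : Pattern p) : ℕ := ∑ e, (m e : ℕ)

/-- The Manhattan distance of two sparsity patterns. -/
def manhattan {p : ℕ} (m m' : Pattern p) : ℤ :=
  ∑ e, |((m e : ℕ) : ℤ) - ((m' e : ℕ) : ℤ)|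

/-- The neighbours of `m` on the hypercube. -/
def neighbours {p : ℕ} (m : Pattern p) : Set (Pattern p) := {m' | manhattan m m' = 1}

/-- The (unordered) edges of the graph with sparsity pattern `m`. -/
def edgeSet {p : ℕ} (m : Pattern p) : Set (Sym2 (Fin p)) :=
  {s | ∃ e : EdgeIdx p, m e = 1 ∧ s = s(e.1.1, e.1.2)}

/-- The empirical covariance matrix `(1/n) ∑ xᵢ xᵢᵀ` of a (centred) sample in `ℝᵖ`. -/
def empiricalCov {n p : ℕ} (x : Fin n → Fin p → ℝ) : Matrix (Fin p) (Fin p) ℝ :=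
  (1 / (n : ℝ)) • ∑ i, Matrix.vecMulVec (x i) (x i)

/-- The positive definite matrices whose off-diagonal entries vanish off the edges of `m`. -/
def constraintSet {p : ℕ} (m : Pattern p) : Set (Matrix (Fin p) (Fin p) ℝ) :=
  {Θ | Θ.PosDef ∧ ∀ i j, i ≠ j → s(i, j) ∉ edgeSet m → Θ i j = 0}

/-- `Θ` maximizes `log det Θ - tr (A Θ)` over the constraint set of the pattern `m`. -/
def IsConstrainedMLE {p : ℕ} (A : Matrix (Fin p) (Fin p) ℝ) (m : Pattern p)
    (Θ : Matrix (Fin p) (Fin p) ℝ) : Prop :=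
  Θ ∈ constraintSet m ∧
    IsMaxOn (fun Ξ => Real.log Ξ.det - (A * Ξ).trace) (constraintSet m) Θ

/-- The individual estimator of pattern `m` built from the sample `x`: the constrained maximum
likelihood estimator (an arbitrary matrix when no maximizer exists). -/
def indivEstimator {n p : ℕ} (x : Fin n → Fin p → ℝ) (m : Pattern p) :
    Matrix (Fin p) (Fin p) ℝ :=
  Classical.epsilon (IsConstrainedMLE (empiricalCov x) m)

/-- The unnormalized prior `(|m|₁ / (e p (p - 1))) ^ |m|₁`, with `0 ^ 0 = 1`. -/
def priorNumerator {p : ℕ} (m : Pattern p) : ℝ :=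
  ((patternNorm m : ℝ) / (Real.exp 1 * (p : ℝ) * ((p : ℝ) - 1))) ^ patternNorm m

/-- The complexity prior: the normalization of `priorNumerator` to a probability vector. -/
def complexityPrior {p : ℕ} (m : Pattern p) : ℝ :=
  (1 / ∑ m' : Pattern p, priorNumerator m') * priorNumerator m

/-- The prior that is uniform on the number of edges, and conditionally uniform on the patterns
with that number of edges. -/
def cardinalityPrior {p : ℕ} (m : Pattern p) : ℝ :=
  ((((p * (p - 1) / 2 : ℕ) : ℝ) + 1) * ((p * (p - 1) / 2).choose (patternNorm m) : ℝ))⁻¹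

/-- The flat prior, uniform on the hypercube. -/
def flatPrior {p : ℕ} (_m : Pattern p) : ℝ := 1 / (Fintype.card (Pattern p) : ℝ)

/-- The unnormalized weight `exp((n₂/2)(log det Θ̂ₘ - tr(Θ̂ₘ S))) πₘ`. -/
def weightNumerator {n₁ p : ℕ} (π : Pattern p → ℝ) (x : Fin n₁ → Fin p → ℝ) (n₂ : ℕ)
    (S : Matrix (Fin p) (Fin p) ℝ) (m : Pattern p) : ℝ :=
  Real.exp (((n₂ : ℝ) / 2) *
    (Real.log (indivEstimator x m).det - (indivEstimator x m * S).trace)) * π m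

/-- The gES weights `vₘ`. -/
def weight {n₁ p : ℕ} (π : Pattern p → ℝ) (x : Fin n₁ → Fin p → ℝ) (n₂ : ℕ)
    (S : Matrix (Fin p) (Fin p) ℝ) (m : Pattern p) : ℝ :=
  weightNumerator π x n₂ S m / ∑ m' : Pattern p, weightNumerator π x n₂ S m'

/-- The gES estimator `∑ₘ vₘ Θ̂ₘ` over the whole hypercube of patterns. -/
def gesEstimator {n₁ p : ℕ} (π : Pattern p → ℝ) (x : Fin n₁ → Fin p → ℝ) (n₂ : ℕ)
    (S : Matrix (Fin p) (Fin p) ℝ) : Matrix (Fin p) (Fin p) ℝ :=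
  ∑ m : Pattern p, weight π x n₂ S m • indivEstimator x m

/-- The proposal given the trajectory `(m₀, …, mₜ)`: uniform on the neighbours of `mₜ`. -/
def proposalKernel (p t : ℕ) : Kernel (Fin (t + 1) → Pattern p) (Pattern p) where
  toFun h := uniformOn (neighbours (h (Fin.last t)))
  measurable' := measurable_of_countable _

/-- `chain` is a run of the Metropolis–Hastings algorithm with target weights `v` on the
probability space `(Ω, P)`: `prop t` is the proposal and `unif t` the random number drawn at
time `t`. -/
structure IsMetropolisHastings {p : ℕ} (v : Pattern p → ℝ) {Ω : Type*} [MeasurableSpace Ω]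
    (P : Measure Ω) (chain prop : ℕ → Ω → Pattern p) (unif : ℕ → Ω → ℝ) : Prop where
  /-- The chain starts at the pattern without edges. -/
  init : ∀ ω, chain 0 ω = fun _ => 0
  /-- Given the chain so far, the proposal is uniform on the neighbours of the current state. -/
  proposal : ∀ t, HasCondDistrib (prop t) (fun ω (s : Fin (t + 1)) => chain s ω)
    (proposalKernel p t) P
  /-- The random number is uniform on `[0, 1]`. -/
  uniform : ∀ t, HasLaw (unif t) (volume.restrict (Set.Icc (0 : ℝ) 1)) P
  /-- The random number is drawn independently of the chain so far and of the proposal. -/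
  indep : ∀ t, IndepFun (unif t)
    (fun ω => ((fun s : Fin (t + 1) => chain s ω), prop t ω)) P
  /-- The accept/reject step. -/
  step : ∀ t ω, chain (t + 1) ω =
    if unif t ω < min 1 (v (prop t ω) / v (chain t ω)) then prop t ω else chain t ω

end GES

end

/-! The proof is a martingale argument through the Poisson equation. All vertices of the hypercube
have equally many neighbours, so the proposal is symmetric and `v x * acceptProb v x y = min (v x)
(v y)` gives detailed balance with respect to `v`. Since all weights are positive and the hypercube
is connected, the weighted generator is the Laplacian of a connected network, hence onto the
functions of zero sum: any `f` with `∑ m, v m * f m = 0` has a solution `g` of the Poisson equation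
(`exists_poisson`).

Then `g (X (t+1)) - g (X t) + f (X t)` are bounded martingale differences. They are orthogonal, so
their averages vanish almost surely (`ae_tendsto_average_of_orthogonal`), and they differ from those
of `f` by a telescoping term of size `O(1/T)`. Only Cesàro averages occur, so aperiodicity plays no
role. The theorem follows by centring each matrix entry. -/

/-! ### Strong law for bounded orthogonal variables. -/

/-- A sequence with bounded increments whose Cesàro quotient vanishes along the squares has
vanishing Cesàro quotient. -/
theorem tendsto_div_zero_of_squares {s : ℕ → ℝ} {C : ℝ} (hs : ∀ n, |s (n + 1) - s n| ≤ C)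
    (h : Tendsto (fun k : ℕ => s (k ^ 2) / (k : ℝ) ^ 2) atTop (𝓝 0)) :
    Tendsto (fun n : ℕ => s n / (n : ℝ)) atTop (𝓝 0) := by
  have hC : 0 ≤ C := (abs_nonneg _).trans (hs 0)
  have hinc : ∀ n d, |s (n + d)| ≤ |s n| + C * d := by
    intro n d
    induction d with
    | zero => simp
    | succ d ih =>
      have h1 := abs_add_le (s (n + d)) (s (n + d + 1) - s (n + d))
      have h2 := hs (n + d)
      rw [add_sub_cancel] at h1
      push_cast
      rw [← add_assoc]
      linarith
  have hsqrt : Tendsto Nat.sqrt atTop atTop :=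
    tendsto_atTop_atTop.2 fun b => ⟨b * b, fun n hn => Nat.le_sqrt.2 hn⟩
  have hlim : Tendsto (fun k : ℕ => |s (k ^ 2) / (k : ℝ) ^ 2| + 2 * C / k) atTop (𝓝 0) := by
    simpa using h.abs.add (tendsto_const_div_atTop_nhds_zero_nat (2 * C))
  refine squeeze_zero_norm' ?_ (hlim.comp hsqrt)
  filter_upwards [eventually_ge_atTop 1] with n hn
  have hk : 1 ≤ Nat.sqrt n := Nat.le_sqrt.2 (by simpa using hn)
  have hk' : (0 : ℝ) < Nat.sqrt n := by exact_mod_cast hk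
  obtain ⟨d, hd⟩ := Nat.exists_eq_add_of_le (Nat.sqrt_le' n)
  -- Consecutive squares `k ^ 2` and `(k + 1) ^ 2` are `2 * k + 1` apart, so the gap is negligible
  -- against `k ^ 2`.
  have hd2 : d ≤ 2 * Nat.sqrt n := by
    have := Nat.sqrt_le_add n
    nlinarith
  have h1 : |s n| ≤ |s (Nat.sqrt n ^ 2)| + C * (2 * Nat.sqrt n) := by
    have h2 := hinc (Nat.sqrt n ^ 2) d
    rw [← hd] at h2
    have h3 : (d : ℝ) ≤ 2 * Nat.sqrt n := by exact_mod_cast hd2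
    have := mul_le_mul_of_nonneg_left h3 hC
    linarith
  have hkn : ((Nat.sqrt n : ℝ)) ^ 2 ≤ n := by exact_mod_cast Nat.sqrt_le' n
  have hn0 : (0 : ℝ) < n := by exact_mod_cast hn
  simp only [Function.comp, Real.norm_eq_abs, abs_div, Nat.abs_cast, abs_pow]
  calc |s n| / n ≤ (|s (Nat.sqrt n ^ 2)| + C * (2 * Nat.sqrt n)) / n := by gcongr
    _ ≤ (|s (Nat.sqrt n ^ 2)| + C * (2 * Nat.sqrt n)) / (Nat.sqrt n : ℝ) ^ 2 := by gcongr
    _ = _ := by field_simp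

/-- The strong law of large numbers for uniformly bounded orthogonal random variables. -/
theorem ae_tendsto_average_of_orthogonal {Ω : Type*} [MeasurableSpace Ω] {P : Measure Ω}
    [IsProbabilityMeasure P] {D : ℕ → Ω → ℝ} {C : ℝ} (hm : ∀ n, AEMeasurable (D n) P)
    (hD : ∀ n ω, |D n ω| ≤ C) (ho : ∀ i j, i < j → ∫ ω, D i ω * D j ω ∂P = 0) :
    ∀ᵐ ω ∂P, Tendsto (fun n : ℕ => (∑ i ∈ Finset.range n, D i ω) / (n : ℝ)) atTop (𝓝 0) := by
  have hint2 : ∀ i j, Integrable (fun ω => D i ω * D j ω) P := fun i j =>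
    Integrable.of_bound ((hm i).mul (hm j)).aestronglyMeasurable (C * C) <| .of_forall fun ω => by
      rw [norm_mul]
      exact mul_le_mul (hD i ω) (hD j ω) (norm_nonneg _) ((abs_nonneg _).trans (hD i ω))
  have hsm : ∀ n, AEMeasurable (fun ω => ∑ i ∈ Finset.range n, D i ω) P := fun n =>
    Finset.aemeasurable_fun_sum _ fun i _ => hm i
  -- Orthogonality removes the cross terms, so the second moment grows only linearly.
  have hsq : ∀ n, Integrable (fun ω => (∑ i ∈ Finset.range n, D i ω) ^ 2) P ∧
      ∫ ω, (∑ i ∈ Finset.range n, D i ω) ^ 2 ∂P ≤ n * C ^ 2 := by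
    intro n
    induction n with
    | zero => simp
    | succ n ih =>
      have e : ∀ ω, (∑ i ∈ Finset.range (n + 1), D i ω) ^ 2 =
          (∑ i ∈ Finset.range n, D i ω) ^ 2 + 2 * (∑ i ∈ Finset.range n, D i ω * D n ω)
            + D n ω * D n ω := by
        intro ω
        rw [Finset.sum_range_succ, ← Finset.sum_mul]
        ring
      simp only [e]
      have i1 : Integrable (fun ω => 2 * ∑ i ∈ Finset.range n, D i ω * D n ω) P :=
        (integrable_finsetSum _ fun i _ => hint2 i n).const_mul 2
      have i2 : Integrable (fun ω => (∑ i ∈ Finset.range n, D i ω) ^ 2 +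
          2 * ∑ i ∈ Finset.range n, D i ω * D n ω) P := ih.1.add i1
      refine ⟨i2.add (hint2 n n), ?_⟩
      rw [integral_add i2 (hint2 n n), integral_add ih.1 i1, integral_const_mul,
        integral_finsetSum _ fun i _ => hint2 i n,
        Finset.sum_eq_zero fun i hi => ho i n (Finset.mem_range.1 hi)]
      have : ∫ ω, D n ω * D n ω ∂P ≤ C ^ 2 := by
        calc ∫ ω, D n ω * D n ω ∂P ≤ ∫ _, C ^ 2 ∂P := by
              refine integral_mono (hint2 n n) (integrable_const _) fun ω => ?_
              have := sq_le_sq' (abs_le.1 (hD n ω)).1 (abs_le.1 (hD n ω)).2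
              simpa [sq] using this
          _ = C ^ 2 := by simp
      push_cast
      linarith [ih.2]
  -- Along the squares the second moments are at most `C ^ 2 / k ^ 2`, which is summable; hence the
  -- series of squared averages converges almost surely and its terms tend to zero.
  have hsub : ∀ᵐ ω ∂P, Tendsto (fun k : ℕ =>
      (∑ i ∈ Finset.range (k ^ 2), D i ω) / (k : ℝ) ^ 2) atTop (𝓝 0) := by
    have hk : ∀ k : ℕ, ∫⁻ ω, ENNReal.ofReal
        (((∑ i ∈ Finset.range (k ^ 2), D i ω) / (k : ℝ) ^ 2) ^ 2) ∂P ≤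
          ENNReal.ofReal (C ^ 2 * (1 / (k : ℝ) ^ 2)) := by
      intro k
      rw [← ofReal_integral_eq_lintegral_ofReal]
      · simp only [div_pow]
        rw [integral_div]
        refine ENNReal.ofReal_le_ofReal ?_
        rcases Nat.eq_zero_or_pos k with rfl | hk
        · simp
        · have hk' : (0 : ℝ) < k := by exact_mod_cast hk
          rw [div_le_iff₀ (by positivity)]
          refine (hsq _).2.trans (le_of_eq ?_)
          push_cast
          field_simp
      · simp only [div_pow]
        exact (hsq _).1.div_const _
      · exact .of_forall fun ω => by positivity
    have hfin : ∫⁻ ω, ∑' k : ℕ, ENNReal.ofReal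
        (((∑ i ∈ Finset.range (k ^ 2), D i ω) / (k : ℝ) ^ 2) ^ 2) ∂P ≠ ⊤ := by
      rw [lintegral_tsum fun k => (((hsm _).div_const _).pow_const 2).ennreal_ofReal]
      refine ne_top_of_le_ne_top ?_ (ENNReal.tsum_le_tsum hk)
      exact (((Real.summable_one_div_nat_pow).2 one_lt_two).mul_left (C ^ 2)).tsum_ofReal_ne_top
    filter_upwards [ae_lt_top' (AEMeasurable.tsum
      fun k => (((hsm _).div_const _).pow_const 2).ennreal_ofReal) hfin] with ω hω
    have h0 := ENNReal.tendsto_atTop_zero_of_tsum_ne_top hω.ne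
    have h1 := (ENNReal.tendsto_toReal ENNReal.zero_ne_top).comp h0
    have h2 := (Real.continuous_sqrt.tendsto 0).comp (by simpa using h1)
    rw [Real.sqrt_zero] at h2
    rw [tendsto_zero_iff_abs_tendsto_zero]
    refine h2.congr fun k => ?_
    simp only [Function.comp]
    rw [ENNReal.toReal_ofReal (by positivity), Real.sqrt_sq_eq_abs]
  filter_upwards [hsub] with ω hω
  refine tendsto_div_zero_of_squares (C := C) (fun n => ?_) hω
  rw [Finset.sum_range_succ, add_sub_cancel_left]
  exact hD n ω

/-! ### Solvability of the Laplace equation on a finite network. -/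

/-- The Laplacian of a symmetric nonnegative connected conductance maps onto the functions with
zero sum. -/
theorem exists_laplacian_eq {S : Type*} [Fintype S] [Nonempty S] {c : S → S → ℝ}
    (hc : ∀ x y, c x y = c y x) (hc0 : ∀ x y, 0 ≤ c x y)
    (hconn : ∀ g : S → ℝ, (∀ x y, 0 < c x y → g x = g y) → ∀ x y, g x = g y)
    {f : S → ℝ} (hf : ∑ x, f x = 0) :
    ∃ g : S → ℝ, ∀ x, ∑ y, c x y * (g x - g y) = f x := by
  have hA : ∀ g : S → ℝ, ∑ x, ∑ y, c x y * (g x - g y) = 0 := by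
    intro g
    have : ∑ x, ∑ y, c x y * (g x - g y) = -∑ x, ∑ y, c x y * (g x - g y) := by
      conv_lhs => rw [Finset.sum_comm]
      simp only [← Finset.sum_neg_distrib]
      refine Finset.sum_congr rfl fun x _ => Finset.sum_congr rfl fun y _ => ?_
      rw [hc y x]
      ring
    linarith
  -- Dirichlet energy identity: summation by parts, using the symmetry of `c`.
  have hE : ∀ g : S → ℝ, 2 * ∑ x, g x * ∑ y, c x y * (g x - g y) =
      ∑ x, ∑ y, c x y * (g x - g y) ^ 2 := by
    intro g
    have h1 : ∑ x, g x * ∑ y, c x y * (g x - g y) = ∑ x, ∑ y, c x y * (g y * (g y - g x)) := by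
      rw [Finset.sum_comm]
      refine Finset.sum_congr rfl fun x _ => ?_
      rw [Finset.mul_sum]
      refine Finset.sum_congr rfl fun y _ => ?_
      rw [hc y x]
      ring
    rw [two_mul]
    nth_rewrite 2 [h1]
    rw [← Finset.sum_add_distrib]
    refine Finset.sum_congr rfl fun x _ => ?_
    rw [Finset.mul_sum, ← Finset.sum_add_distrib]
    refine Finset.sum_congr rfl fun y _ => ?_
    ring
  -- The Laplacian kills constants; adding the total mass makes it injective, hence surjective in
  -- finite dimension. On functions of zero sum the added term disappears.
  let B : (S → ℝ) →ₗ[ℝ] (S → ℝ) :=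
    { toFun := fun g x => ∑ y, c x y * (g x - g y) + ∑ y, g y
      map_add' := fun g h => by
        ext x
        simp only [Pi.add_apply, Finset.sum_add_distrib, add_sub_add_comm, mul_add]
        ring
      map_smul' := fun a g => by
        ext x
        simp only [Pi.smul_apply, smul_eq_mul, RingHom.id_apply, mul_add, Finset.mul_sum]
        congr 1
        exact Finset.sum_congr rfl fun y _ => by ring }
  have hB : ∀ g x, B g x = ∑ y, c x y * (g x - g y) + ∑ y, g y := fun _ _ => rfl
  have hS : (Fintype.card S : ℝ) ≠ 0 := by exact_mod_cast Fintype.card_ne_zero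
  have hBsum : ∀ g, ∑ x, B g x = Fintype.card S * ∑ y, g y := by
    intro g
    simp only [hB, Finset.sum_add_distrib, hA, zero_add, Finset.sum_const, Finset.card_univ,
      nsmul_eq_mul]
  have hinj : Function.Injective B := by
    refine (injective_iff_map_eq_zero B).2 fun g hg => ?_
    have hg0 : ∑ y, g y = 0 := by
      have := hBsum g
      simp only [hg, Pi.zero_apply, Finset.sum_const_zero] at this
      exact (mul_eq_zero.1 this.symm).resolve_left hS
    have hg1 : ∀ x, ∑ y, c x y * (g x - g y) = 0 := fun x => by
      have := hB g x
      rw [hg, hg0, add_zero] at this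
      exact this.symm
    have hg2 : ∑ x, ∑ y, c x y * (g x - g y) ^ 2 = 0 := by simp [← hE, hg1]
    have hnn : ∀ x y, 0 ≤ c x y * (g x - g y) ^ 2 := fun x y => mul_nonneg (hc0 x y) (sq_nonneg _)
    have hg3 : ∀ x y, c x y * (g x - g y) ^ 2 = 0 := fun x y => by
      have h1 := (Finset.sum_eq_zero_iff_of_nonneg
        fun x _ => Finset.sum_nonneg fun y _ => hnn x y).1 hg2 x (Finset.mem_univ x)
      exact (Finset.sum_eq_zero_iff_of_nonneg fun y _ => hnn x y).1 h1 y (Finset.mem_univ y)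
    have hg4 := hconn g fun x y hxy => by
      have := (mul_eq_zero.1 (hg3 x y)).resolve_left hxy.ne'
      exact sub_eq_zero.1 (pow_eq_zero_iff two_ne_zero |>.1 this)
    ext x
    have : ∑ y, g y = Fintype.card S * g x := by
      rw [Finset.sum_congr rfl fun y _ => hg4 y x]
      simp
    rw [hg0] at this
    exact (mul_eq_zero.1 this.symm).resolve_left hS
  obtain ⟨g, hg⟩ := LinearMap.injective_iff_surjective.1 hinj f
  have hg0 : ∑ y, g y = 0 := by
    have := hBsum g
    rw [hg, hf] at this
    exact (mul_eq_zero.1 this.symm).resolve_left hS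
  exact ⟨g, fun x => by rw [← hg, hB, hg0, add_zero]⟩

/-! ### Regularity and connectedness of the hypercube. -/

namespace GES

variable {p : ℕ}

/-- Addition in `Fin 2` is exclusive or, so the hypercube becomes a Cayley graph and translations
can be used. -/
theorem manhattan_eq_patternNorm_add (m m' : Pattern p) :
    manhattan m m' = (patternNorm (m + m') : ℤ) := by
  have h : ∀ a b : Fin 2, |((a : ℕ) : ℤ) - ((b : ℕ) : ℤ)| = ((a + b : Fin 2) : ℕ) := by decide
  simp [manhattan, patternNorm, h]

theorem pattern_add_self (m : Pattern p) : m + m = 0 := by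
  have h : ∀ a : Fin 2, a + a = 0 := by decide
  exact funext fun e => h _

theorem mem_neighbours_iff (m m' : Pattern p) : m' ∈ neighbours m ↔ patternNorm (m + m') = 1 := by
  rw [neighbours, Set.mem_ofPred_eq, manhattan_eq_patternNorm_add]
  norm_cast

theorem mem_neighbours_comm (m m' : Pattern p) : m' ∈ neighbours m ↔ m ∈ neighbours m' := by
  rw [mem_neighbours_iff, mem_neighbours_iff, add_comm]

theorem add_single_mem_neighbours (m : Pattern p) (e : EdgeIdx p) :
    m + Pi.single e 1 ∈ neighbours m := by
  rw [mem_neighbours_iff, ← add_assoc, pattern_add_self, zero_add, patternNorm,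
    Finset.sum_eq_single e]
  · simp
  · intro b _ hb
    simp [Pi.single_eq_of_ne hb]
  · simp

/-- Translation by `m` is injective and carries the neighbours of `0` onto those of `m`. -/
theorem count_neighbours (m : Pattern p) :
    Measure.count (neighbours m) = Measure.count (neighbours (0 : Pattern p)) := by
  have h : neighbours m = (fun m' => m + m') '' neighbours (0 : Pattern p) := by
    ext m'
    simp only [Set.mem_image, mem_neighbours_iff, zero_add]
    constructor
    · exact fun h => ⟨m + m', h, by rw [← add_assoc, pattern_add_self, zero_add]⟩
    · rintro ⟨k, hk, rfl⟩
      rwa [← add_assoc, pattern_add_self, zero_add]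
  rw [h]
  exact Measure.count_injective_image (add_right_injective m) _

/-- The probability that the proposal from `m` is `m'`. -/
noncomputable def proposalProb (m m' : Pattern p) : ℝ := (uniformOn (neighbours m)).real {m'}

theorem proposalProb_comm (m m' : Pattern p) : proposalProb m m' = proposalProb m' m := by
  classical
  -- The normalizing count no longer depends on `a`, which leaves only the symmetric neighbour
  -- relation.
  have h : ∀ a b : Pattern p, proposalProb a b =
      ((Measure.count (neighbours (0 : Pattern p)))⁻¹ *
        if b ∈ neighbours a then 1 else 0).toReal := by
    intro a b
    rw [proposalProb, Measure.real, uniformOn, cond_apply (Set.toFinite _).measurableSet,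
      count_neighbours]
    split_ifs with hb
    · rw [Set.inter_eq_right.2 (Set.singleton_subset_iff.2 hb), Measure.count_singleton]
    · rw [Set.inter_singleton_eq_empty.2 hb, measure_empty]
  rw [h, h]
  simp only [mem_neighbours_comm m m']

theorem proposalProb_pos {m m' : Pattern p} (h : m' ∈ neighbours m) : 0 < proposalProb m m' := by
  rw [proposalProb, measureReal_def]
  refine ENNReal.toReal_pos ?_ (measure_ne_top _ _)
  rw [Ne, uniformOn_eq_zero_iff (Set.toFinite _), Set.inter_singleton_eq_empty]
  exact not_not_intro h

/-- The hypercube is connected through neighbours. -/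
theorem eq_of_forall_neighbours {g : Pattern p → ℝ}
    (hg : ∀ m, ∀ m' ∈ neighbours m, g m = g m') (m m' : Pattern p) : g m = g m' := by
  suffices h : ∀ m, g m = g 0 by rw [h m, h m']
  -- Induction on a set containing the support: flipping one coordinate equal to `1` shrinks it.
  have key : ∀ s : Finset (EdgeIdx p), ∀ m : Pattern p, (∀ e ∉ s, m e = 0) → g m = g 0 := by
    intro s
    induction s using Finset.induction_on with
    | empty => exact fun m hm => congrArg g (funext fun e => hm e (by simp))
    | insert a s ha ih =>
      intro m hm
      have h01 : m a = 0 ∨ m a = 1 := by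
        generalize m a = b
        revert b
        decide
      rcases h01 with h | h
      · refine ih m fun e he => ?_
        by_cases hea : e = a
        · rw [hea, h]
        · exact hm e (by simp [hea, he])
      · rw [hg m _ (add_single_mem_neighbours m a)]
        refine ih _ fun e he => ?_
        by_cases hea : e = a
        · subst hea
          simp [h]
        · simp [Pi.single_eq_of_ne hea, hm e (by simp [hea, he])]
  exact fun m => key Finset.univ m (by simp)

instance (t : ℕ) : IsFiniteKernel (proposalKernel p t) :=
  ⟨1, ENNReal.one_lt_top, fun h => by
    change uniformOn _ _ ≤ 1
    exact prob_le_one⟩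

/-! ### One step of the Metropolis–Hastings chain. -/

/-- The Metropolis–Hastings acceptance probability. -/
noncomputable def acceptProb (v : Pattern p → ℝ) (m m' : Pattern p) : ℝ := min 1 (v m' / v m)

variable {v : Pattern p → ℝ} {Ω : Type*} [MeasurableSpace Ω] {P : Measure Ω}
  {chain prop : ℕ → Ω → Pattern p} {unif : ℕ → Ω → ℝ}

theorem IsMetropolisHastings.aemeasurable_history (h : IsMetropolisHastings v P chain prop unif)
    (t : ℕ) : AEMeasurable (fun ω (s : Fin (t + 1)) => chain s ω) P :=
  (h.proposal t).aemeasurable_fst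

theorem IsMetropolisHastings.aemeasurable_chain (h : IsMetropolisHastings v P chain prop unif)
    (t : ℕ) : AEMeasurable (chain t) P :=
  (measurable_pi_apply (Fin.last t)).comp_aemeasurable (h.aemeasurable_history t)

theorem integral_indicator_lt_uniform {a : ℝ} (h0 : 0 ≤ a) (h1 : a ≤ 1) :
    ∫ u, (if u < a then (1 : ℝ) else 0) ∂(volume.restrict (Set.Icc (0 : ℝ) 1)) = a := by
  have : (fun u : ℝ => if u < a then (1 : ℝ) else 0) = (Set.Iio a).indicator 1 := by
    ext u
    simp [Set.indicator]
  rw [this, integral_indicator_one measurableSet_Iio, measureReal_restrict_apply measurableSet_Iio]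
  have : Set.Iio a ∩ Set.Icc (0 : ℝ) 1 = Set.Ico 0 a := by
    ext u
    simp only [Set.mem_inter_iff, Set.mem_Iio, Set.mem_Icc, Set.mem_Ico]
    constructor
    · exact fun h => ⟨h.2.1, h.1⟩
    · exact fun h => ⟨h.2, h.1, by linarith⟩
  rw [this]
  simp [h0]

variable [IsProbabilityMeasure P]

/-- Integrating out an independent uniform random number in an accept/reject step. -/
theorem integral_mul_ite_lt_uniform {Z : Type*} [Fintype Z] [MeasurableSpace Z]
    [DiscreteMeasurableSpace Z] {z : Ω → Z} {u : Ω → ℝ} (hz : AEMeasurable z P)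
    (hu : HasLaw u (volume.restrict (Set.Icc (0 : ℝ) 1)) P) (hi : IndepFun u z P)
    (φ α : Z → ℝ) (h0 : ∀ a, 0 ≤ α a) (h1 : ∀ a, α a ≤ 1) :
    ∫ ω, φ (z ω) * (if u ω < α (z ω) then 1 else 0) ∂P = ∫ ω, φ (z ω) * α (z ω) ∂P := by
  have : IsProbabilityMeasure (P.map z) := Measure.isProbabilityMeasure_map hz
  have hmap : P.map (fun ω => (z ω, u ω)) =
      (P.map z).prod (volume.restrict (Set.Icc (0 : ℝ) 1)) := by
    rw [(indepFun_iff_map_prod_eq_prod_map_map hz hu.aemeasurable).1 hi.symm, hu.map_eq]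
  have hF : Measurable fun q : Z × ℝ => φ q.1 * (if q.2 < α q.1 then (1 : ℝ) else 0) := by
    refine ((measurable_of_countable φ).comp measurable_fst).mul (Measurable.ite ?_ ?_ ?_)
    · exact measurableSet_lt measurable_snd ((measurable_of_countable α).comp measurable_fst)
    · exact measurable_const
    · exact measurable_const
  obtain ⟨K, hK⟩ := (Set.finite_range fun a => |φ a|).bddAbove
  have hint : Integrable (fun q : Z × ℝ => φ q.1 * (if q.2 < α q.1 then (1 : ℝ) else 0))
      ((P.map z).prod (volume.restrict (Set.Icc (0 : ℝ) 1))) := by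
    refine Integrable.of_bound hF.aestronglyMeasurable K (.of_forall fun q => ?_)
    have hq : |φ q.1| ≤ K := hK ⟨q.1, rfl⟩
    split_ifs
    · simpa using hq
    · simpa using (abs_nonneg _).trans hq
  calc ∫ ω, φ (z ω) * (if u ω < α (z ω) then 1 else 0) ∂P
      = ∫ q, φ q.1 * (if q.2 < α q.1 then (1 : ℝ) else 0) ∂(P.map fun ω => (z ω, u ω)) :=
        (integral_map (hz.prodMk hu.aemeasurable) hF.aestronglyMeasurable).symm
    _ = ∫ a, φ a * α a ∂(P.map z) := by
        rw [hmap, integral_prod _ hint]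
        refine integral_congr_ae (.of_forall fun a => ?_)
        simp only
        rw [integral_const_mul, integral_indicator_lt_uniform (h0 a) (h1 a)]
    _ = ∫ ω, φ (z ω) * α (z ω) ∂P :=
        integral_map hz (measurable_of_countable fun a => φ a * α a).aestronglyMeasurable

/-- The conditional expectation of an increment of the chain, tested against a function of the
history. -/
theorem IsMetropolisHastings.integral_history_mul_increment
    (h : IsMetropolisHastings v P chain prop unif) (hv : ∀ m, 0 ≤ v m) (t : ℕ)
    (φ : (Fin (t + 1) → Pattern p) → ℝ) (g : Pattern p → ℝ) :
    ∫ ω, φ (fun s => chain s ω) * (g (chain (t + 1) ω) - g (chain t ω)) ∂P =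
      ∫ ω, φ (fun s => chain s ω) * ∑ y, proposalProb (chain t ω) y *
        (acceptProb v (chain t ω) y * (g y - g (chain t ω))) ∂P := by
  let ψ : (Fin (t + 1) → Pattern p) × Pattern p → ℝ :=
    fun q => φ q.1 * (g q.2 - g (q.1 (Fin.last t)))
  let α : (Fin (t + 1) → Pattern p) × Pattern p → ℝ :=
    fun q => acceptProb v (q.1 (Fin.last t)) q.2
  calc ∫ ω, φ (fun s => chain s ω) * (g (chain (t + 1) ω) - g (chain t ω)) ∂P
      = ∫ ω, ψ (fun s => chain s ω, prop t ω) *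
          (if unif t ω < α (fun s => chain s ω, prop t ω) then 1 else 0) ∂P := by
        refine integral_congr_ae (.of_forall fun ω => ?_)
        change φ _ * (g (chain (t + 1) ω) - g (chain t ω)) = φ _ * (g (prop t ω) - g (chain t ω)) *
          (if unif t ω < min 1 (v (prop t ω) / v (chain t ω)) then 1 else 0)
        rw [h.step t ω]
        -- After a rejection the increment of `g` is zero, so the acceptance indicator can be
        -- factored out.
        split_ifs <;> simp
    _ = ∫ ω, ψ (fun s => chain s ω, prop t ω) * α (fun s => chain s ω, prop t ω) ∂P :=
        integral_mul_ite_lt_uniform (h.proposal t).aemeasurable (h.uniform t) (h.indep t) ψ α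
          (fun q => le_min zero_le_one (div_nonneg (hv _) (hv _))) fun q => min_le_left _ _
    _ = ∫ q, ψ q * α q ∂((P.map fun ω (s : Fin (t + 1)) => chain s ω) ⊗ₘ proposalKernel p t) := by
        rw [← (h.proposal t).map_eq]
        exact (integral_map (h.proposal t).aemeasurable
          (measurable_of_countable fun q => ψ q * α q).aestronglyMeasurable).symm
    _ = ∫ a, φ a * ∑ y, proposalProb (a (Fin.last t)) y *
          (acceptProb v (a (Fin.last t)) y * (g y - g (a (Fin.last t))))
          ∂(P.map fun ω (s : Fin (t + 1)) => chain s ω) := by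
        rw [Measure.integral_compProd .of_finite]
        refine integral_congr_ae (.of_forall fun a => ?_)
        simp only
        rw [integral_fintype .of_finite, Finset.mul_sum]
        refine Finset.sum_congr rfl fun y _ => ?_
        simp only [ψ, α, smul_eq_mul, proposalProb]
        change (uniformOn (neighbours (a (Fin.last t)))).real {y} * _ = _
        ring
    _ = _ := integral_map (h.aemeasurable_history t) (measurable_of_countable _).aestronglyMeasurable

/-! ### Poisson equation and ergodic theorem. -/

/-- Solvability of the Poisson equation of the Metropolis–Hastings chain. -/
theorem exists_poisson (hv : ∀ m, 0 < v m) {f : Pattern p → ℝ} (hf : ∑ m, v m * f m = 0) :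
    ∃ g : Pattern p → ℝ, ∀ x, ∑ y, proposalProb x y * (acceptProb v x y * (g y - g x)) = -f x := by
  -- Detailed balance: the right side is symmetric in `x` and `y`.
  have hva : ∀ x y, v x * acceptProb v x y = min (v x) (v y) := fun x y => by
    rw [acceptProb, mul_min_of_nonneg _ _ (hv x).le, mul_one, mul_div_cancel₀ _ (hv x).ne']
  obtain ⟨g, hg⟩ := exists_laplacian_eq (c := fun x y => proposalProb x y * min (v x) (v y))
    (fun x y => by rw [proposalProb_comm, min_comm])
    (fun x y => mul_nonneg measureReal_nonneg (le_min (hv x).le (hv y).le))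
    (fun g hg => eq_of_forall_neighbours fun m m' hm' =>
      hg m m' (mul_pos (proposalProb_pos hm') (lt_min (hv m) (hv m')))) hf
  refine ⟨g, fun x => mul_left_cancel₀ (hv x).ne' ?_⟩
  rw [mul_neg, ← hg, Finset.mul_sum, ← Finset.sum_neg_distrib]
  refine Finset.sum_congr rfl fun y _ => ?_
  rw [← hva]
  ring

/-- The ergodic theorem for the Metropolis–Hastings chain, for functions of mean zero. -/
theorem IsMetropolisHastings.ae_tendsto_average_of_sum_eq_zero
    (h : IsMetropolisHastings v P chain prop unif) (hv : ∀ m, 0 < v m) {f : Pattern p → ℝ}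
    (hf : ∑ m, v m * f m = 0) (a : ℕ) :
    ∀ᵐ ω ∂P, Tendsto (fun T : ℕ => (∑ i ∈ Finset.range T, f (chain (a + i) ω)) / (T : ℝ))
      atTop (𝓝 0) := by
  obtain ⟨g, hg⟩ := exists_poisson hv hf
  obtain ⟨K, hK⟩ := (Set.finite_range fun m => |g m|).bddAbove
  obtain ⟨K', hK'⟩ := (Set.finite_range fun m => |f m|).bddAbove
  replace hK : ∀ m, |g m| ≤ K := fun m => hK ⟨m, rfl⟩
  replace hK' : ∀ m, |f m| ≤ K' := fun m => hK' ⟨m, rfl⟩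
  have hint : ∀ s t (F : Pattern p → Pattern p → Pattern p → Pattern p → ℝ),
      Integrable (fun ω => F (chain s ω) (chain (s + 1) ω) (chain t ω) (chain (t + 1) ω)) P := by
    intro s t F
    have hm : AEMeasurable
        (fun ω => (chain s ω, chain (s + 1) ω, chain t ω, chain (t + 1) ω)) P :=
      (h.aemeasurable_chain _).prodMk ((h.aemeasurable_chain _).prodMk
        ((h.aemeasurable_chain _).prodMk (h.aemeasurable_chain _)))
    have := Measure.isProbabilityMeasure_map hm
    exact (Integrable.of_finite (μ := P.map _)
      (f := fun q : Pattern p × Pattern p × Pattern p × Pattern p => F q.1 q.2.1 q.2.2.1 q.2.2.2))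
        |>.comp_aemeasurable hm
  have hav := ae_tendsto_average_of_orthogonal (P := P) (C := 2 * K + K')
    (D := fun i ω => g (chain (a + i + 1) ω) - g (chain (a + i) ω) + f (chain (a + i) ω))
    (fun i => (hint (a + i) 0 fun x y _ _ => g y - g x + f x).aemeasurable)
    (fun i ω => by
      have h1 := abs_le.1 (hK (chain (a + i + 1) ω))
      have h2 := abs_le.1 (hK (chain (a + i) ω))
      have h3 := abs_le.1 (hK' (chain (a + i) ω))
      exact abs_le.2 ⟨by linarith, by linarith⟩)
    (fun i j hij => by
      -- The earlier difference is a function of the history up to time `a + j`, because `i < j`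
      -- gives `a + i + 1 ≤ a + j`. Tested against it, the increment of `g` contributes `-f`, which
      -- cancels the added `f`.
      let φ : (Fin (a + j + 1) → Pattern p) → ℝ := fun q =>
        g (q ⟨a + i + 1, by omega⟩) - g (q ⟨a + i, by omega⟩) + f (q ⟨a + i, by omega⟩)
      have key := h.integral_history_mul_increment (fun m => (hv m).le) (a + j) φ g
      simp only [hg, φ] at key
      simp only [mul_add (_ + _)]
      rw [integral_add
        (hint (a + i) (a + j) fun x y z w => (g y - g x + f x) * (g w - g z))
        (hint (a + i) (a + j) fun x y z w => (g y - g x + f x) * f z), key, ← integral_add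
        (hint (a + i) (a + j) fun x y z w => (g y - g x + f x) * -f z)
        (hint (a + i) (a + j) fun x y z w => (g y - g x + f x) * f z)]
      simp)
  filter_upwards [hav] with ω hω
  have htel : ∀ T : ℕ, ∑ i ∈ Finset.range T, f (chain (a + i) ω) =
      (∑ i ∈ Finset.range T,
        (g (chain (a + i + 1) ω) - g (chain (a + i) ω) + f (chain (a + i) ω)))
        - (g (chain (a + T) ω) - g (chain a ω)) := by
    intro T
    have := Finset.sum_range_sub (fun i => g (chain (a + i) ω)) T
    rw [Finset.sum_add_distrib]
    simp only [add_zero] at this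
    simp only [add_assoc] at this ⊢
    rw [this]
    ring
  have hbd : Tendsto (fun T : ℕ => (g (chain (a + T) ω) - g (chain a ω)) / (T : ℝ))
      atTop (𝓝 0) := by
    refine squeeze_zero_norm (fun T => ?_) (tendsto_const_div_atTop_nhds_zero_nat (2 * K))
    rw [norm_div, Real.norm_natCast]
    refine div_le_div_of_nonneg_right ?_ T.cast_nonneg
    have h1 := abs_le.1 (hK (chain (a + T) ω))
    have h2 := abs_le.1 (hK (chain a ω))
    exact abs_le.2 ⟨by linarith, by linarith⟩
  simpa only [htel, sub_div, sub_zero] using hω.sub hbd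

/-- The ergodic theorem for the Metropolis–Hastings chain. -/
theorem IsMetropolisHastings.ae_tendsto_average
    (h : IsMetropolisHastings v P chain prop unif) (hv : ∀ m, 0 < v m) (hv1 : ∑ m, v m = 1)
    (f : Pattern p → ℝ) (T₀ : ℕ) :
    ∀ᵐ ω ∂P, Tendsto (fun T : ℕ => (1 / (T : ℝ)) *
      ∑ t ∈ Finset.Icc (T₀ + 1) (T₀ + T), f (chain t ω)) atTop (𝓝 (∑ m, v m * f m)) := by
  have hz : ∑ m, v m * (f m - ∑ m', v m' * f m') = 0 := by
    simp only [mul_sub, Finset.sum_sub_distrib, ← Finset.sum_mul, hv1, one_mul, sub_self]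
  filter_upwards [h.ae_tendsto_average_of_sum_eq_zero hv hz (T₀ + 1)] with ω hω
  have := hω.add_const (∑ m, v m * f m)
  rw [zero_add] at this
  refine this.congr' ?_
  filter_upwards [eventually_ge_atTop 1] with T hT
  have hT' : (T : ℝ) ≠ 0 := by exact_mod_cast (by omega : T ≠ 0)
  have hI : Finset.Icc (T₀ + 1) (T₀ + T) = Finset.Ico (T₀ + 1) (T₀ + 1 + T) := by
    ext
    simp only [Finset.mem_Icc, Finset.mem_Ico]
    omega
  rw [hI, Finset.sum_Ico_eq_sum_range, add_tsub_cancel_left, Finset.sum_sub_distrib,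
    Finset.sum_const, Finset.card_range, nsmul_eq_mul]
  field_simp
  ring

/-! ### Positivity of the priors and the weights. -/

theorem card_edgeIdx (p : ℕ) : Fintype.card (EdgeIdx p) = p * (p - 1) / 2 := by
  rw [Fintype.card_subtype, Finset.card_filter, Fintype.sum_prod_type_right,
    ← Finset.sum_range_id, Finset.sum_range]
  refine Finset.sum_congr rfl fun j _ => ?_
  rw [← Finset.card_filter, Finset.filter_gt_eq_Iio, Fin.card_Iio]

/-- Keeps the binomial coefficient in `cardinalityPrior` from vanishing. -/
theorem patternNorm_le (m : Pattern p) : patternNorm m ≤ p * (p - 1) / 2 := by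
  rw [← card_edgeIdx, patternNorm, ← Finset.card_univ]
  refine (Finset.sum_le_card_nsmul _ _ 1 fun e _ => ?_).trans (by simp)
  have := (m e).isLt
  omega

theorem priorNumerator_pos (hp : 2 ≤ p) (m : Pattern p) : 0 < priorNumerator m := by
  have hp' : (2 : ℝ) ≤ p := by exact_mod_cast hp
  rw [priorNumerator]
  rcases Nat.eq_zero_or_pos (patternNorm m) with h | h
  · simp [h]
  · have h' : (0 : ℝ) < patternNorm m := by exact_mod_cast h
    have : (0 : ℝ) < p - 1 := by linarith
    positivity

theorem prior_pos (hp : 2 ≤ p) {π : Pattern p → ℝ}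
    (hπ : π = complexityPrior ∨ π = cardinalityPrior ∨ π = flatPrior) (m : Pattern p) :
    0 < π m := by
  rcases hπ with rfl | rfl | rfl
  · exact mul_pos (one_div_pos.2 (Finset.sum_pos (fun m _ => priorNumerator_pos hp m)
      Finset.univ_nonempty)) (priorNumerator_pos hp m)
  · have : (0 : ℝ) < ((p * (p - 1) / 2).choose (patternNorm m) : ℝ) := by
      exact_mod_cast Nat.choose_pos (patternNorm_le m)
    rw [cardinalityPrior]
    positivity
  · have : (0 : ℝ) < Fintype.card (Pattern p) := by exact_mod_cast Fintype.card_pos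
    rw [flatPrior]
    positivity

theorem sum_weightNumerator_pos {n₁ n₂ : ℕ} {π : Pattern p → ℝ} (hπ : ∀ m, 0 < π m)
    (x : Fin n₁ → Fin p → ℝ) (S : Matrix (Fin p) (Fin p) ℝ) :
    0 < ∑ m, weightNumerator π x n₂ S m :=
  Finset.sum_pos (fun m _ => mul_pos (Real.exp_pos _) (hπ m)) Finset.univ_nonempty

theorem weight_pos {n₁ n₂ : ℕ} {π : Pattern p → ℝ} (hπ : ∀ m, 0 < π m)
    (x : Fin n₁ → Fin p → ℝ) (S : Matrix (Fin p) (Fin p) ℝ) (m : Pattern p) :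
    0 < weight π x n₂ S m :=
  div_pos (mul_pos (Real.exp_pos _) (hπ m)) (sum_weightNumerator_pos hπ x S)

theorem sum_weight {n₁ n₂ : ℕ} {π : Pattern p → ℝ} (hπ : ∀ m, 0 < π m)
    (x : Fin n₁ → Fin p → ℝ) (S : Matrix (Fin p) (Fin p) ℝ) :
    ∑ m, weight π x n₂ S m = 1 := by
  simp only [weight]
  rw [← Finset.sum_div, div_self (sum_weightNumerator_pos hπ x S).ne']

end GES

theorem mainTheorem3 {p n₁ n₂ : ℕ} (hp : 2 ≤ p)
    (x₁ : Fin n₁ → Fin p → ℝ) (x₂ : Fin n₂ → Fin p → ℝ)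
    (covEst : (Fin n₂ → Fin p → ℝ) → Matrix (Fin p) (Fin p) ℝ)
    (hMLE : ∀ m : GES.Pattern p, ∃! Θ : Matrix (Fin p) (Fin p) ℝ,
      GES.IsConstrainedMLE (GES.empiricalCov x₁) m Θ)
    (π : GES.Pattern p → ℝ)
    (hπ : π = GES.complexityPrior ∨ π = GES.cardinalityPrior ∨ π = GES.flatPrior)
    {Ω : Type*} [MeasurableSpace Ω] (P : Measure Ω) [IsProbabilityMeasure P]
    (chain prop : ℕ → Ω → GES.Pattern p) (unif : ℕ → Ω → ℝ)
    (hMH : GES.IsMetropolisHastings (GES.weight π x₁ n₂ (covEst x₂)) P chain prop unif)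
    (T₀ : ℕ) :
    ∀ᵐ ω ∂P, Tendsto
      (fun T : ℕ => (1 / (T : ℝ)) •
        ∑ t ∈ Finset.Icc (T₀ + 1) (T₀ + T), GES.indivEstimator x₁ (chain t ω))
      atTop (𝓝 (GES.gesEstimator π x₁ n₂ (covEst x₂))) := by
  have hpos := GES.prior_pos hp hπ
  -- There are finitely many entries, so one null set serves them all.
  have hall : ∀ᵐ ω ∂P, ∀ i j, Tendsto (fun T : ℕ => (1 / (T : ℝ)) *
      ∑ t ∈ Finset.Icc (T₀ + 1) (T₀ + T), GES.indivEstimator x₁ (chain t ω) i j) atTop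
      (𝓝 (∑ m, GES.weight π x₁ n₂ (covEst x₂) m * GES.indivEstimator x₁ m i j)) :=
    ae_all_iff.2 fun i => ae_all_iff.2 fun j =>
      hMH.ae_tendsto_average (GES.weight_pos hpos x₁ _) (GES.sum_weight hpos x₁ _)
        (fun m => GES.indivEstimator x₁ m i j) T₀
  filter_upwards [hall] with ω hω
  refine tendsto_pi_nhds.2 fun i => tendsto_pi_nhds.2 fun j => ?_
  simpa [GES.gesEstimator, Matrix.sum_apply] using hω i j
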